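/- **Language.** Formulas are built from a countably infinite set $Pr$ of propositional variables by $\land,\lor,\to$ (binary) and $\neg,\Box,\Box_L$ (unary); $\varphi\leftrightarrow\psi:=(\varphi\to\psi)\land(\psi\to\varphi)$. **Frames.** A frame is $(S,\le,R,{}^*,Q,Q_L)$ with $(S,\le)$ a poset, $R\subseteq S^3$ antitone in its first two arguments and monotone in the third, ${}^*:S\to S$ antitone, and $Q,Q_L\subseteq S^2$ antitone in the first and monotone in the second argument. It is bounded if $S$ has a least element $0$ and a greatest element $1$ such that $1^*=0$, $0^*=1$, $Q00$, $Q_L00$, ($Q1s\Rightarrow s=1$), ($Q_L1s\Rightarrow s=1$), $R010$, and ($R1st\Rightarrow s=0$ or $t=1$). In a bounded frame $w\in S$ is a possible world if $w^*=w$, $Rwww$, and for all $s,t$: $Rwst\Rightarrow(s=0$ or $w\le t)$ and $Rwst\Rightarrow(t=1$ or $s\le w^*)$. A $W$-frame is a bounded frame with a set $W$ of possible worlds such that ($w\in W$, $Q_Lwu$, $Rust\Rightarrow s\le t$) and $\forall s\,\exists w\in W\,\exists u\,(Q_Lwu$ and $Russ)$. Put $Q_L(W)=\{u: Q_Lwu\text{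 for some }w\in W\}$. **Models and validity.** A $W$-model adds to a $W$-frame a map $V$ from $Pr$ to upward closed sets with $1\in V(p)$ and $0\notin V(p)$ for all $p$. Satisfaction: $s\models p$ iff $s\in V(p)$; $\land,\lor$ are pointwise; $s\models\neg\varphi$ iff $s^*\not\models\varphi$; $s\models\varphi\to\psi$ iff for all $t,u$ with $Rstu$, $t\models\varphi$ implies $u\models\psi$; $s\models\Box\varphi$ (resp. $\Box_L\varphi$) iff $t\models\varphi$ whenever $Qst$ (resp. $Q_Lst$). A formula is valid in a class of $W$-frames if it holds at every $w\in W$ in every $W$-model based on a frame of the class. **Conditions.** Let $\Lambda$ be any selection from the following frame conditions, each with an axiom or rule. Write $Rstuv:=\exists x(Rstx\,\&\,Rxuv)$, $Rs(tu)v:=\exists x(Rsxv\,\&\,Rtux)$, $RQstu:=\exists x(Rstx\,\&\,Qxu)$, $QRstu:=\exists x(Qsx\,\&\,Rxtu)$. Free variables are universally quantified. - (DN) $s^{**}=s$; axiom $p\leftrightarrow\neg\neg p$ - (Cp) $Rstu\Rightarrow Rsu^*t^*$; $(p\to q)\to(\neg q\to\neg p)$ - (WB) $Rstu\Rightarrow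 Rs(st)u$; $((p\to q)\land(q\to r))\to(p\to r)$ - (X) $s\in Q_L(W)\Rightarrow s^*\le s$; $p\lor\neg p$ - (Rd) $Rss^*s$; $(p\to q)\to(\neg p\lor q)$ - (B) $Rstuv\Rightarrow Rs(tu)v$; $(p\to q)\to((r\to p)\to(r\to q))$ - (CB) $Rstuv\Rightarrow Rt(su)v$; $(p\to q)\to((q\to r)\to(p\to r))$ - (W) $Rstu\Rightarrow Rsttu$; $(p\to(p\to q))\to(p\to q)$ - (C) $Rstuv\Rightarrow Rsutv$; $(p\to(q\to r))\to(q\to(p\to r))$ - (M) $Rstu\Rightarrow(s\le u$ or $t\le u)$; $p\to(p\to p)$ - (ER) $\exists x(x\in Q_L(W)\,\&\,Rsxs)$; rule $\varphi\,/\,(\varphi\to\psi)\to\psi$ - (Nec) $(x\in Q_L(W)\,\&\,Qxs)\Rightarrow s\in Q_L(W)$; rule $\varphi\,/\,\Box\varphi$ - ($\Box$K) $RQstu\Rightarrow\exists x(Qtx\,\&\,QRsxu)$; $\Box(p\to q)\to(\Box p\to\Box q)$ - ($\Box$T) $Qss$; $\Box p\to p$ - ($\Box$D) $\exists x(Qsx^*\,\&\,Qs^*x)$;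 $\Box p\to\neg\Box\neg p$ - ($\Box$4) $(Qst\,\&\,Qtu)\Rightarrow Qsu$; $\Box p\to\Box\Box p$ - ($\Box$5) $(Qs^*u\,\&\,Qst)\Rightarrow Qt^*u$; $\neg\Box p\to\Box\neg\Box p$ A $\mathbf{CL}$-frame (for $\Lambda$) is a $W$-frame satisfying all conditions in $\Lambda$. **Axiom systems.** $\mathsf{L}$ (for $\Lambda$) has the axioms $p\to p$; $\neg(p\land q)\to(\neg p\lor\neg q)$; $(\neg p\land\neg q)\to\neg(p\lor q)$; $(p\land q)\to p$; $(p\land q)\to q$; $p\to(p\lor q)$; $q\to(p\lor q)$; $((p\to q)\land(p\to r))\to(p\to(q\land r))$; $((p\to r)\land(q\to r))\to((p\lor q)\to r)$; $(p\land(q\lor r))\to((p\land q)\lor(p\land r))$; $(\Box p\land\Box q)\to\Box(p\land q)$; $(\Box_Lp\land\Box_Lq)\to\Box_L(p\land q)$; the rules uniform substitution, modus ponens, $\varphi,\psi/\varphi\land\psi$; $\varphi'\to\varphi,\ \psi\to\psi'/(\varphi\to\psi)\to(\varphi'\to\psi')$; $\varphi\to\psi/\neg\psi\to\neg\varphi$;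 $\varphi\to\psi/\Box_L\varphi\to\Box_L\psi$; $\varphi\to\psi/\Box\varphi\to\Box\psi$; and the axioms and rules attached to the members of $\Lambda$. The system $\mathsf{CL}$ consists of: classical propositional logic with modus ponens and uniform substitution of arbitrary formulas for variables; the axiom $\Box_L\varphi$ for each axiom $\varphi$ of $\mathsf{L}$ and the rule $\Box_L\varphi_1,\dots,\Box_L\varphi_n/\Box_L\psi$ for each rule $\varphi_1,\dots,\varphi_n/\psi$ of $\mathsf{L}$; and the Bridge Rule $\Box_L(\varphi\to\psi)/\varphi\to\psi$. **Theorem.** (1) For every selection $\Lambda$, a formula is a theorem of $\mathsf{CL}$ if and only if it is valid in the class of all $\mathbf{CL}$-frames. (2) If moreover (DN) belongs to $\Lambda$, or neither (Rd) nor ($\Box$D) does, then the same holds when the axioms attached to (Rd) and ($\Box$D) are replaced by $(p\to\neg p)\to\neg p$ and $\Box\neg p\to\neg\Box p$ respectively. -/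

import Mathlib

/-! Relevant modal logics, their classical companions, and bounded `W`-frames. -/

universe u

namespace RelML

/-! ### The language -/

/-- Formulas of the modal language over the countable set `ℕ` of propositional variables;
`boxL` is the auxiliary operator `□_L`. -/
inductive Form : Type where
  | var : ℕ → Form
  | conj : Form → Form → Form
  | disj : Form → Form → Form
  | imp : Form → Form → Form
  | neg : Form → Form
  | box : Form → Form
  | boxL : Form → Form

infixr:65 " ⋏ " => Form.conj
infixr:64 " ⋎ " => Form.disj
infixr:60 " ⇛ " => Form.imp
prefix:75 "∼" => Form.neg
prefix:75 "□" => Form.box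
prefix:75 "⊡" => Form.boxL

/-- `φ ↔ ψ` is the abbreviation `(φ → ψ) ∧ (ψ → φ)`. -/
def Form.iff (φ ψ : Form) : Form := (φ ⇛ ψ) ⋏ (ψ ⇛ φ)

/-- Uniform substitution. -/
def Form.subst (σ : ℕ → Form) : Form → Form
  | .var n => σ n
  | .conj φ ψ => φ.subst σ ⋏ ψ.subst σ
  | .disj φ ψ => φ.subst σ ⋎ ψ.subst σ
  | .imp φ ψ => φ.subst σ ⇛ ψ.subst σ
  | .neg φ => ∼φ.subst σ
  | .box φ => □φ.subst σ
  | .boxL φ => ⊡φ.subst σ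

/-- The first of the variables `p`, `q`, `r` used to write down axioms. -/
abbrev p : Form := .var 0

/-- The second variable. -/
abbrev q : Form := .var 1

/-- The third variable. -/
abbrev r : Form := .var 2

/-! ### Hilbert systems -/

/-- A Hilbert-style system: a set of axioms and a set of instances `(premises, conclusion)` of
inference rules. -/
structure AxSystem where
  axioms : Set Form
  rules : Set (List Form × Form)

/-- Provability in a Hilbert-style system. -/
inductive AxSystem.Provable (A : AxSystem) : Form → Prop where
  | ax {φ : Form} : φ ∈ A.axioms → A.Provable φ
  | rule {Γ : List Form} {φ : Form} :
      (Γ, φ) ∈ A.rules → (∀ ψ ∈ Γ, A.Provable ψ) → A.Provable φ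

/-- `Th(A)`, the set of theorems of `A`. -/
def AxSystem.Th (A : AxSystem) : Set Form := {φ | A.Provable φ}

/-- The axioms (a1)-(a12) of `BM.C`. -/
inductive BMCAxiom : Form → Prop where
  | a1 : BMCAxiom (p ⇛ p)
  | a2 : BMCAxiom (∼(p ⋏ q) ⇛ (∼p ⋎ ∼q))
  | a3 : BMCAxiom ((∼p ⋏ ∼q) ⇛ ∼(p ⋎ q))
  | a4 : BMCAxiom ((p ⋏ q) ⇛ p)
  | a5 : BMCAxiom ((p ⋏ q) ⇛ q)
  | a6 : BMCAxiom (p ⇛ (p ⋎ q))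
  | a7 : BMCAxiom (q ⇛ (p ⋎ q))
  | a8 : BMCAxiom (((p ⇛ q) ⋏ (p ⇛ r)) ⇛ (p ⇛ (q ⋏ r)))
  | a9 : BMCAxiom (((p ⇛ r) ⋏ (q ⇛ r)) ⇛ ((p ⋎ q) ⇛ r))
  | a10 : BMCAxiom ((p ⋏ (q ⋎ r)) ⇛ ((p ⋏ q) ⋎ (p ⋏ r)))
  | a11 : BMCAxiom ((□p ⋏ □q) ⇛ □(p ⋏ q))
  | a12 : BMCAxiom ((⊡p ⋏ ⊡q) ⇛ ⊡(p ⋏ q))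

/-- The inference rules of `BM.C`. -/
inductive BMCRule : List Form × Form → Prop where
  | us (σ : ℕ → Form) (φ : Form) : BMCRule ([φ], φ.subst σ)
  | mp (φ ψ : Form) : BMCRule ([φ, φ ⇛ ψ], ψ)
  | adj (φ ψ : Form) : BMCRule ([φ, ψ], φ ⋏ ψ)
  | aff (φ φ' ψ ψ' : Form) : BMCRule ([φ' ⇛ φ, ψ ⇛ ψ'], (φ ⇛ ψ) ⇛ (φ' ⇛ ψ'))
  | con (φ ψ : Form) : BMCRule ([φ ⇛ ψ], ∼ψ ⇛ ∼φ)
  | boxLMon (φ ψ : Form) : BMCRule ([φ ⇛ ψ], ⊡φ ⇛ ⊡ψ)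
  | boxMon (φ ψ : Form) : BMCRule ([φ ⇛ ψ], □φ ⇛ □ψ)

/-- Names of the optional frame conditions, and of the axioms or rules corresponding to them. -/
inductive Cond : Type where
  | DN | Cp | WB | X | Rd | B | CB | W | C | M | ER | Nec
  | boxK | boxT | boxD | box4 | box5

/-- The axiom tabulated for a condition; `ER` and `Nec` contribute a rule instead of an axiom. -/
def tableAxiom : Cond → Set Form
  | .DN => {Form.iff p (∼∼p)}
  | .Cp => {(p ⇛ q) ⇛ (∼q ⇛ ∼p)}
  | .WB => {((p ⇛ q) ⋏ (q ⇛ r)) ⇛ (p ⇛ r)}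
  | .X => {p ⋎ ∼p}
  | .Rd => {(p ⇛ ∼p) ⇛ ∼p}
  | .B => {(p ⇛ q) ⇛ ((r ⇛ p) ⇛ (r ⇛ q))}
  | .CB => {(p ⇛ q) ⇛ ((q ⇛ r) ⇛ (p ⇛ r))}
  | .W => {(p ⇛ (p ⇛ q)) ⇛ (p ⇛ q)}
  | .C => {(p ⇛ (q ⇛ r)) ⇛ (q ⇛ (p ⇛ r))}
  | .M => {p ⇛ (p ⇛ p)}
  | .ER => ∅
  | .Nec => ∅
  | .boxK => {□(p ⇛ q) ⇛ (□p ⇛ □q)}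
  | .boxT => {□p ⇛ p}
  | .boxD => {□∼p ⇛ ∼□p}
  | .box4 => {□p ⇛ □□p}
  | .box5 => {∼□p ⇛ □∼□p}

/-- The axiom that corresponds to a condition when double negation (`DN`) is not assumed. It
differs from `tableAxiom` at `Rd` and `boxD` only, where the two are interderivable in the
presence of `DN`. -/
def exactAxiom : Cond → Set Form
  | .Rd => {(p ⇛ q) ⇛ (∼p ⋎ q)}
  | .boxD => {□p ⇛ ∼□∼p}
  | c => tableAxiom c

/-- The rule instances contributed by a condition. -/
def condRule : Cond → Set (List Form × Form)
  | .ER => {x | ∃ φ ψ : Form, x = ([φ], (φ ⇛ ψ) ⇛ ψ)}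
  | .Nec => {x | ∃ φ : Form, x = ([φ], □φ)}
  | _ => ∅

/-- The axiom system of the relevant modal logic given by the selection `Λ` of conditions, where
`ax` assigns an axiom to each condition. -/
def relSystem (ax : Cond → Set Form) (Λ : Set Cond) : AxSystem where
  axioms := {φ | BMCAxiom φ} ∪ ⋃ c ∈ Λ, ax c
  rules := {x | BMCRule x} ∪ ⋃ c ∈ Λ, condRule c

/-- Axioms of classical propositional logic (complete together with modus ponens and uniform
substitution). -/
inductive CPCAxiom : Form → Prop where
  | k : CPCAxiom (p ⇛ (q ⇛ p))
  | s : CPCAxiom ((p ⇛ (q ⇛ r)) ⇛ ((p ⇛ q) ⇛ (p ⇛ r)))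
  | conjLeft : CPCAxiom ((p ⋏ q) ⇛ p)
  | conjRight : CPCAxiom ((p ⋏ q) ⇛ q)
  | conjIntro : CPCAxiom (p ⇛ (q ⇛ (p ⋏ q)))
  | disjLeft : CPCAxiom (p ⇛ (p ⋎ q))
  | disjRight : CPCAxiom (q ⇛ (p ⋎ q))
  | disjElim : CPCAxiom ((p ⇛ r) ⇛ ((q ⇛ r) ⇛ ((p ⋎ q) ⇛ r)))
  | negIntro : CPCAxiom ((p ⇛ q) ⇛ ((p ⇛ ∼q) ⇛ ∼p))
  | dne : CPCAxiom (∼∼p ⇛ p)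

/-- The rules of the classical companion `CL` of an axiom system `A` for `L`: modus ponens, uniform
substitution, the `□_L`-prefixed versions of the rules of `A`, and the Bridge Rule. -/
inductive CLRule (A : AxSystem) : List Form × Form → Prop where
  | mp (φ ψ : Form) : CLRule A ([φ, φ ⇛ ψ], ψ)
  | us (σ : ℕ → Form) (φ : Form) : CLRule A ([φ], φ.subst σ)
  | boxed {Γ : List Form} {φ : Form} :
      (Γ, φ) ∈ A.rules → CLRule A (Γ.map Form.boxL, ⊡φ)
  | bridge (φ ψ : Form) : CLRule A ([⊡(φ ⇛ ψ)], φ ⇛ ψ)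

/-- The axiom system `CL` built from an axiom system `A` for `L`. -/
def AxSystem.classical (A : AxSystem) : AxSystem where
  axioms := {φ | CPCAxiom φ} ∪ Form.boxL '' A.axioms
  rules := {x | CLRule A x}

/-! ### Frames -/

/-- A frame on a partially ordered set of states. -/
structure Frame (S : Type u) [PartialOrder S] where
  R : S → S → S → Prop
  star : S → S
  Q : S → S → Prop
  QL : S → S → Prop
  R_tonic : ∀ {s s' t t' v v' : S}, s' ≤ s → t' ≤ t → v ≤ v' → R s t v → R s' t' v'
  star_anti : ∀ {s t : S}, s ≤ t → star t ≤ star s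
  Q_tonic : ∀ {s s' t t' : S}, s' ≤ s → t ≤ t' → Q s t → Q s' t'
  QL_tonic : ∀ {s s' t t' : S}, s' ≤ s → t ≤ t' → QL s t → QL s' t'

/-- The interpretation of formulas, for a valuation `V` of the propositional variables. -/
def Frame.interp {S : Type u} [PartialOrder S] (F : Frame S) (V : ℕ → Set S) : Form → Set S
  | .var n => V n
  | .conj φ ψ => F.interp V φ ∩ F.interp V ψ
  | .disj φ ψ => F.interp V φ ∪ F.interp V ψ
  | .imp φ ψ => {s | ∀ t v, F.R s t v → t ∈ F.interp V φ → v ∈ F.interp V ψ}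
  | .neg φ => {s | F.star s ∉ F.interp V φ}
  | .box φ => {s | ∀ t, F.Q s t → t ∈ F.interp V φ}
  | .boxL φ => {s | ∀ t, F.QL s t → t ∈ F.interp V φ}

/-- Interpretations of formulas are upward closed as soon as the valuation is. -/
theorem Frame.interp_upper {S : Type u} [PartialOrder S] (F : Frame S) (V : ℕ → Set S)
    (hV : ∀ n, IsUpperSet (V n)) (φ : Form) : IsUpperSet (F.interp V φ) := by
  induction φ with
  | var n => exact hV n
  | conj φ ψ h1 h2 => exact h1.inter h2
  | disj φ ψ h1 h2 => exact h1.union h2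
  | imp φ ψ _ _ =>
      intro a b hab ha t v hR ht
      exact ha t v (F.R_tonic hab le_rfl le_rfl hR) ht
  | neg φ h =>
      intro a b hab ha hb
      exact ha (h (F.star_anti hab) hb)
  | box φ _ =>
      intro a b hab ha t hQ
      exact ha t (F.Q_tonic hab le_rfl hQ)
  | boxL φ _ =>
      intro a b hab ha t hQ
      exact ha t (F.QL_tonic hab le_rfl hQ)

/-- The optional frame conditions, where `L` is the set of logical states. -/
def Frame.Satisfies {S : Type u} [PartialOrder S] (F : Frame S) (L : Set S) : Cond → Prop
  | .DN => ∀ s, F.star (F.star s) = s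
  | .Cp => ∀ s t v, F.R s t v → F.R s (F.star v) (F.star t)
  | .WB => ∀ s t v, F.R s t v → ∃ x, F.R s x v ∧ F.R s t x
  | .X => ∀ s, s ∈ L → F.star s ≤ s
  | .Rd => ∀ s, F.R s (F.star s) s
  | .B => ∀ s t v z, (∃ x, F.R s t x ∧ F.R x v z) → ∃ x, F.R s x z ∧ F.R t v x
  | .CB => ∀ s t v z, (∃ x, F.R s t x ∧ F.R x v z) → ∃ x, F.R t x z ∧ F.R s v x
  | .W => ∀ s t v, F.R s t v → ∃ x, F.R s t x ∧ F.R x t v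
  | .C => ∀ s t v z, (∃ x, F.R s t x ∧ F.R x v z) → ∃ x, F.R s v x ∧ F.R x t z
  | .M => ∀ s t v, F.R s t v → s ≤ v ∨ t ≤ v
  | .ER => ∀ s, ∃ x, x ∈ L ∧ F.R s x s
  | .Nec => ∀ x s, x ∈ L ∧ F.Q x s → s ∈ L
  | .boxK => ∀ s t v, (∃ y, F.R s t y ∧ F.Q y v) → ∃ x, F.Q t x ∧ ∃ z, F.Q s z ∧ F.R z x v
  | .boxT => ∀ s, F.Q s s
  | .boxD => ∀ s, ∃ x, F.Q s (F.star x) ∧ F.Q (F.star s) x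
  | .box4 => ∀ s t v, F.Q s t ∧ F.Q t v → F.Q s v
  | .box5 => ∀ s t v, F.Q (F.star s) v ∧ F.Q s t → F.Q (F.star t) v

/-- A bounded frame; the bounds `0` and `1` are `⊥` and `⊤`. -/
structure BoundedFrame (S : Type u) [PartialOrder S] [BoundedOrder S] extends Frame S where
  star_top : star ⊤ = ⊥
  star_bot : star ⊥ = ⊤
  Q_bot : Q ⊥ ⊥
  QL_bot : QL ⊥ ⊥
  Q_top : ∀ s, Q ⊤ s → s = ⊤
  QL_top : ∀ s, QL ⊤ s → s = ⊤
  R_bot_top_bot : R ⊥ ⊤ ⊥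
  R_top : ∀ s t, R ⊤ s t → s = ⊥ ∨ t = ⊤

/-- Possible worlds of a bounded frame. -/
structure BoundedFrame.IsWorld {S : Type u} [PartialOrder S] [BoundedOrder S]
    (F : BoundedFrame S) (w : S) : Prop where
  star_eq : F.star w = w
  R_self : F.R w w w
  R_le : ∀ s t, F.R w s t → s = ⊥ ∨ w ≤ t
  R_star : ∀ s t, F.R w s t → t = ⊤ ∨ s ≤ F.star w

/-- A `W`-frame: a bounded frame with a designated set of possible worlds. -/
structure WFrame (S : Type u) [PartialOrder S] [BoundedOrder S] extends BoundedFrame S where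
  W : Set S
  isWorld : ∀ w ∈ W, toBoundedFrame.IsWorld w
  QL_le : ∀ w ∈ W, ∀ s t v, QL w v → R v s t → s ≤ t
  QL_refl : ∀ s, ∃ w ∈ W, ∃ v, QL w v ∧ R v s s

/-- `Q_L(W)`, the set of states that are `Q_L`-accessible from some world in `W`. -/
def WFrame.logical {S : Type u} [PartialOrder S] [BoundedOrder S] (F : WFrame S) : Set S :=
  {s | ∃ w ∈ F.W, F.QL w s}

/-- `F` is a `CL`-frame, where `L` is given by the selection `Λ` of frame conditions: it satisfies
the C-variants of the conditions in `Λ`, in which `s ∈ L` is replaced by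
`∃ w, w ∈ W ∧ Q_L w s`. -/
def WFrame.IsCLFrame {S : Type u} [PartialOrder S] [BoundedOrder S] (F : WFrame S)
    (Λ : Set Cond) : Prop :=
  ∀ c ∈ Λ, F.Satisfies F.logical c

/-- Valuations that are admissible in `W`-models. -/
structure IsValuation {S : Type u} [PartialOrder S] [BoundedOrder S] (V : ℕ → Set S) : Prop where
  upper : ∀ n, IsUpperSet (V n)
  top_mem : ∀ n, ⊤ ∈ V n
  bot_notMem : ∀ n, ⊥ ∉ V n

/-- The logic `CL`: the set of formulas that hold in all worlds in `W` of every model based on a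
`CL`-frame. -/
def CLogic (Λ : Set Cond) : Set Form :=
  {φ | ∀ (S : Type u) [PartialOrder S] [BoundedOrder S] (F : WFrame S), F.IsCLFrame Λ →
    ∀ V : ℕ → Set S, IsValuation V → F.W ⊆ F.interp V φ}

end RelML

namespace RelML

/-! ### Soundness -/

/-! Soundness rests on two translations. At a possible world implication and negation are classical:
the exceptional cases with `⊥` or `⊤` are harmless because every formula holds at `⊤` and fails at
`⊥`. At logical states an implication is true throughout exactly when one interpretation is
contained in the other (`WFrame.logValid_imp_iff`), and a formula prefixed by `⊡` is valid exactly
when its body is true at all logical states. The boxed part of a derivation thus becomes relevant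
reasoning, and the Bridge Rule passes from inclusion to material implication.

Completeness is by a canonical frame. For a consistent companion `C`, let `T` be the set of formulas
whose `⊡`-prefix is in `C`. States are the prime `T`-theories; the empty and the full one supply the
bounds. Worlds are the maximal `C`-consistent sets, which are `T`-theories by the Bridge Rule. The
work lies in `IsLattice.exists_isPrime`, which separates a theory from an ideal: each existential
frame condition asks for a prime theory containing some formulas and avoiding others. Logical states
turn out to be those containing `T`.

The canonical argument uses the axioms valid without double negation. For the other table, (DN)
serves to derive those axioms, and to prove soundness of the (□D) axiom. -/

theorem Frame.interp_subst {S : Type u} [PartialOrder S] (F : Frame S) (V : ℕ → Set S)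
    (σ : ℕ → Form) (φ : Form) :
    F.interp V (φ.subst σ) = F.interp (fun n => F.interp V (σ n)) φ := by
  induction φ <;> simp_all [Form.subst, Frame.interp]

section Soundness

variable {S : Type u} [PartialOrder S] [BoundedOrder S]

/-- Each boundary condition on the frame is what carries the two constraints on valuations through
one connective. -/
theorem BoundedFrame.top_mem_bot_notMem_interp (F : BoundedFrame S) {V : ℕ → Set S}
    (hV : IsValuation V) (φ : Form) : ⊤ ∈ F.interp V φ ∧ ⊥ ∉ F.interp V φ := by
  induction φ with
  | var n => exact ⟨hV.top_mem n, hV.bot_notMem n⟩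
  | conj φ ψ h1 h2 => exact ⟨⟨h1.1, h2.1⟩, fun h => h1.2 h.1⟩
  | disj φ ψ h1 h2 => exact ⟨.inl h1.1, fun h => h.elim h1.2 h2.2⟩
  | imp φ ψ h1 h2 =>
      refine ⟨fun t v hR ht => ?_, fun h => h2.2 (h _ _ F.R_bot_top_bot h1.1)⟩
      rcases F.R_top t v hR with rfl | rfl
      · exact absurd ht h1.2
      · exact h2.1
  | neg φ h =>
      refine ⟨?_, ?_⟩
      · change F.star ⊤ ∉ _
        rw [F.star_top]
        exact h.2
      · change ¬ F.star ⊥ ∉ _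
        rw [F.star_bot]
        exact not_not.2 h.1
  | box φ h =>
      refine ⟨fun t hQ => ?_, fun h' => h.2 (h' _ F.Q_bot)⟩
      rw [F.Q_top t hQ]
      exact h.1
  | boxL φ h =>
      refine ⟨fun t hQ => ?_, fun h' => h.2 (h' _ F.QL_bot)⟩
      rw [F.QL_top t hQ]
      exact h.1

theorem BoundedFrame.isValuation_interp (F : BoundedFrame S) {V : ℕ → Set S}
    (hV : IsValuation V) (σ : ℕ → Form) : IsValuation fun n => F.interp V (σ n) where
  upper n := F.interp_upper V hV.upper (σ n)
  top_mem n := (F.top_mem_bot_notMem_interp hV (σ n)).1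
  bot_notMem n := (F.top_mem_bot_notMem_interp hV (σ n)).2

/-- Worlds behave classically with respect to implication. -/
theorem BoundedFrame.IsWorld.mem_imp_iff {F : BoundedFrame S} {w : S} (hw : F.IsWorld w)
    {V : ℕ → Set S} (hV : IsValuation V) (φ ψ : Form) :
    w ∈ F.interp V (φ ⇛ ψ) ↔ (w ∈ F.interp V φ → w ∈ F.interp V ψ) := by
  refine ⟨fun h => h w w hw.R_self, fun h s t hR hs => ?_⟩
  rcases hw.R_le s t hR with rfl | hwt
  · exact absurd hs (F.top_mem_bot_notMem_interp hV φ).2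
  rcases hw.R_star s t hR with rfl | hsw
  · exact (F.top_mem_bot_notMem_interp hV ψ).1
  rw [hw.star_eq] at hsw
  exact F.interp_upper V hV.upper ψ hwt (h (F.interp_upper V hV.upper φ hsw hs))

theorem BoundedFrame.IsWorld.mem_neg_iff {F : BoundedFrame S} {w : S} (hw : F.IsWorld w)
    {V : ℕ → Set S} (φ : Form) : w ∈ F.interp V (∼φ) ↔ w ∉ F.interp V φ := by
  change F.star w ∉ _ ↔ _
  rw [hw.star_eq]

/-- Validity in a `W`-frame. -/
def WFrame.Valid (F : WFrame S) (φ : Form) : Prop :=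
  ∀ V : ℕ → Set S, IsValuation V → F.W ⊆ F.interp V φ

/-- Truth at every logical state of every model based on a `W`-frame. -/
def WFrame.LogValid (F : WFrame S) (φ : Form) : Prop :=
  ∀ V : ℕ → Set S, IsValuation V → F.logical ⊆ F.interp V φ

theorem WFrame.valid_boxL_iff (F : WFrame S) (φ : Form) : F.Valid (⊡φ) ↔ F.LogValid φ :=
  ⟨fun h V hV s ⟨_, hw, hs⟩ => h V hV hw s hs, fun h V hV _ hw _ hs => h V hV ⟨_, hw, hs⟩⟩

/-- `QL_refl` supplies, for each `s`, a logical state relating `s` to itself; conversely `QL_le`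
makes logical states relate only ordered pairs, and interpretations are upward closed. -/
theorem WFrame.logValid_imp_iff (F : WFrame S) (φ ψ : Form) :
    F.LogValid (φ ⇛ ψ) ↔ ∀ V, IsValuation V → F.interp V φ ⊆ F.interp V ψ := by
  refine ⟨fun h V hV s hs => ?_, fun h V hV v ⟨w, hw, hv⟩ s t hR hs => ?_⟩
  · obtain ⟨w, hw, v, hv, hR⟩ := F.QL_refl s
    exact h V hV ⟨w, hw, hv⟩ s s hR hs
  · exact F.interp_upper V hV.upper ψ (F.QL_le w hw s t v hv hR) (h V hV hs)

theorem WFrame.Valid.subst {F : WFrame S} {φ : Form} (h : F.Valid φ) (σ : ℕ → Form) :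
    F.Valid (φ.subst σ) := fun V hV => by
  rw [F.interp_subst]
  exact h _ (F.isValuation_interp hV σ)

theorem WFrame.LogValid.subst {F : WFrame S} {φ : Form} (h : F.LogValid φ) (σ : ℕ → Form) :
    F.LogValid (φ.subst σ) := fun V hV => by
  rw [F.interp_subst]
  exact h _ (F.isValuation_interp hV σ)

theorem WFrame.valid_cpcAxiom (F : WFrame S) {φ : Form} (h : CPCAxiom φ) : F.Valid φ := by
  intro V hV w hw
  have hi := (F.isWorld w hw).mem_imp_iff hV
  have hn := (F.isWorld w hw).mem_neg_iff (V := V)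
  have hc : ∀ φ ψ, w ∈ F.interp V (φ ⋏ ψ) ↔ w ∈ F.interp V φ ∧ w ∈ F.interp V ψ :=
    fun _ _ => Iff.rfl
  have hd : ∀ φ ψ, w ∈ F.interp V (φ ⋎ ψ) ↔ w ∈ F.interp V φ ∨ w ∈ F.interp V ψ :=
    fun _ _ => Iff.rfl
  cases h <;> simp only [hi, hn, hc, hd] <;> tauto

theorem WFrame.logValid_bmcAxiom (F : WFrame S) {φ : Form} (h : BMCAxiom φ) :
    F.LogValid φ := by
  cases h <;> refine (F.logValid_imp_iff _ _).2 fun V hV s hs => ?_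
  case a1 => exact hs
  case a2 => exact not_and_or.1 hs
  case a3 => exact not_or.2 hs
  case a4 => exact hs.1
  case a5 => exact hs.2
  case a6 => exact .inl hs
  case a7 => exact .inr hs
  case a8 => exact fun t v hR ht => ⟨hs.1 t v hR ht, hs.2 t v hR ht⟩
  case a9 => exact fun t v hR ht => ht.elim (hs.1 t v hR) (hs.2 t v hR)
  case a10 => exact hs.2.imp (⟨hs.1, ·⟩) (⟨hs.1, ·⟩)
  case a11 => exact fun t hQ => ⟨hs.1 t hQ, hs.2 t hQ⟩
  case a12 => exact fun t hQ => ⟨hs.1 t hQ, hs.2 t hQ⟩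

theorem WFrame.logValid_bmcRule (F : WFrame S) {Γ : List Form} {φ : Form}
    (h : BMCRule (Γ, φ)) (hΓ : ∀ ψ ∈ Γ, F.LogValid ψ) : F.LogValid φ := by
  cases h with
  | us σ φ => exact (hΓ φ (by simp)).subst σ
  | mp ψ =>
      have h1 := hΓ ψ (by simp)
      have h2 := (F.logValid_imp_iff _ _).1 (hΓ (ψ ⇛ φ) (by simp))
      exact fun V hV s hs => h2 V hV (h1 V hV hs)
  | adj φ ψ => exact fun V hV s hs => ⟨hΓ φ (by simp) V hV hs, hΓ ψ (by simp) V hV hs⟩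
  | aff φ φ' ψ ψ' =>
      have h1 := (F.logValid_imp_iff _ _).1 (hΓ (φ' ⇛ φ) (by simp))
      have h2 := (F.logValid_imp_iff _ _).1 (hΓ (ψ ⇛ ψ') (by simp))
      exact (F.logValid_imp_iff _ _).2 fun V hV s hs t v hR ht =>
        h2 V hV (hs t v hR (h1 V hV ht))
  | con φ ψ =>
      have h1 := (F.logValid_imp_iff _ _).1 (hΓ (φ ⇛ ψ) (by simp))
      exact (F.logValid_imp_iff _ _).2 fun V hV s hs hs' => hs (h1 V hV hs')
  | boxLMon φ ψ =>
      have h1 := (F.logValid_imp_iff _ _).1 (hΓ (φ ⇛ ψ) (by simp))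
      exact (F.logValid_imp_iff _ _).2 fun V hV s hs t hQ => h1 V hV (hs t hQ)
  | boxMon φ ψ =>
      have h1 := (F.logValid_imp_iff _ _).1 (hΓ (φ ⇛ ψ) (by simp))
      exact (F.logValid_imp_iff _ _).2 fun V hV s hs t hQ => h1 V hV (hs t hQ)

theorem WFrame.logValid_condRule (F : WFrame S) {c : Cond} (hc : F.Satisfies F.logical c)
    {Γ : List Form} {φ : Form} (h : (Γ, φ) ∈ condRule c) (hΓ : ∀ ψ ∈ Γ, F.LogValid ψ) :
    F.LogValid φ := by
  cases c <;> try exact h.elim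
  case ER =>
    obtain ⟨φ, ψ, h⟩ := h
    obtain ⟨rfl, rfl⟩ := Prod.mk.inj h
    refine (F.logValid_imp_iff _ _).2 fun V hV s hs => ?_
    obtain ⟨x, hx, hR⟩ := hc s
    exact hs x s hR (hΓ φ (by simp) V hV hx)
  case Nec =>
    obtain ⟨φ, h⟩ := h
    obtain ⟨rfl, rfl⟩ := Prod.mk.inj h
    exact fun V hV x hx s hQ => hΓ φ (by simp) V hV (hc x s ⟨hx, hQ⟩)

theorem WFrame.logValid_exactAxiom (F : WFrame S) {c : Cond} (hc : F.Satisfies F.logical c)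
    {φ : Form} (h : φ ∈ exactAxiom c) : F.LogValid φ := by
  cases c <;> try exact h.elim
  all_goals
    obtain rfl := h
  case DN =>
    have h1 : F.LogValid (p ⇛ ∼∼p) := (F.logValid_imp_iff _ _).2 fun V hV s hs h' =>
      h' (by rw [hc s]; exact hs)
    have h2 : F.LogValid (∼∼p ⇛ p) := (F.logValid_imp_iff _ _).2 fun V hV s hs => by
      have := not_not.1 hs
      rwa [hc s] at this
    exact fun V hV s hs => ⟨h1 V hV hs, h2 V hV hs⟩
  case X =>
    intro V hV s hs
    by_cases h : F.star s ∈ V 0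
    · exact .inl (hV.upper 0 (hc s hs) h)
    · exact .inr h
  all_goals refine (F.logValid_imp_iff _ _).2 fun V hV s hs => ?_
  case Cp => exact fun t v hR ht hv => ht (hs _ _ (hc s t v hR) hv)
  case WB =>
    intro t v hR ht
    obtain ⟨x, h1, h2⟩ := hc s t v hR
    exact hs.2 x v h1 (hs.1 t x h2 ht)
  case Rd =>
    by_cases h : F.star s ∈ V 0
    · exact .inr (hs _ _ (hc s) h)
    · exact .inl h
  case B =>
    intro t x h1 ht v z h2 hv
    obtain ⟨y, h3, h4⟩ := hc s t v z ⟨x, h1, h2⟩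
    exact hs _ _ h3 (ht _ _ h4 hv)
  case CB =>
    intro t x h1 ht v z h2 hv
    obtain ⟨y, h3, h4⟩ := hc s t v z ⟨x, h1, h2⟩
    exact ht _ _ h3 (hs _ _ h4 hv)
  case W =>
    intro t v hR ht
    obtain ⟨x, h1, h2⟩ := hc s t v hR
    exact hs t x h1 ht t v h2 ht
  case C =>
    intro t x h1 ht v z h2 hv
    obtain ⟨y, h3, h4⟩ := hc s t v z ⟨x, h1, h2⟩
    exact hs _ _ h3 hv _ _ h4 ht
  case M =>
    intro t v hR ht
    exact (hc s t v hR).elim (hV.upper 0 · hs) (hV.upper 0 · ht)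
  case boxK =>
    intro t y hR ht v hQ
    obtain ⟨x, h1, z, h2, h3⟩ := hc s t v ⟨y, hR, hQ⟩
    exact hs z h2 x v h3 (ht x h1)
  case boxT => exact hs s (hc s)
  case boxD =>
    intro h
    obtain ⟨x, h1, h2⟩ := hc s
    exact h x h2 (hs _ h1)
  case box4 => exact fun t h1 v h2 => hs v (hc s t v ⟨h1, h2⟩)
  case box5 => exact fun t h1 h2 => hs fun v h3 => h2 v (hc s t v ⟨h3, h1⟩)

/-- Only (□D) needs double negation here: its condition mentions `star x`, and evaluating `∼p` there
produces a second star. The (Rd) axiom is sound without it. -/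
theorem WFrame.logValid_tableAxiom (F : WFrame S) {c : Cond} (hc : F.Satisfies F.logical c)
    (hDN : c = .boxD → F.Satisfies F.logical .DN) {φ : Form} (h : φ ∈ tableAxiom c) :
    F.LogValid φ := by
  by_cases hRd : c = .Rd
  · subst hRd
    obtain rfl := h
    refine (F.logValid_imp_iff _ _).2 fun V hV s hs h' => ?_
    exact hs _ _ (hc s) h' h'
  by_cases hD : c = .boxD
  · subst hD
    obtain rfl := h
    refine (F.logValid_imp_iff _ _).2 fun V hV s hs h' => ?_
    obtain ⟨x, h1, h2⟩ := hc s
    have h3 : F.star (F.star x) ∉ V 0 := hs _ h1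
    rw [hDN rfl x] at h3
    exact h3 (h' x h2)
  · refine F.logValid_exactAxiom hc ?_
    cases c <;> first | exact h | contradiction

/-- The axiom table is left as a parameter so that both parts of the theorem share the induction on
derivations. -/
theorem soundness {ax : Cond → Set Form} {Λ : Set Cond}
    (hax : ∀ (S : Type u) [PartialOrder S] [BoundedOrder S] (F : WFrame S), F.IsCLFrame Λ →
      ∀ c ∈ Λ, ∀ φ ∈ ax c, F.LogValid φ) :
    (relSystem ax Λ).classical.Th ⊆ CLogic.{u} Λ := by
  intro φ hφ S _ _ F hF
  change F.Valid φ
  induction hφ with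
  | @ax φ h =>
      rcases h with h | ⟨ψ, h, rfl⟩
      · exact F.valid_cpcAxiom h
      refine (F.valid_boxL_iff ψ).2 ?_
      rcases h with h | h
      · exact F.logValid_bmcAxiom h
      · obtain ⟨c, hc, h⟩ := Set.mem_iUnion₂.1 h
        exact hax S F hF c hc ψ h
  | @rule Γ φ h _ ih =>
      cases h with
      | mp ψ =>
          intro V hV w hw
          exact ((F.isWorld w hw).mem_imp_iff hV ψ φ).1 (ih (ψ ⇛ φ) (by simp) V hV hw)
            (ih ψ (by simp) V hV hw)
      | us σ φ => exact (ih φ (by simp)).subst σ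
      | bridge φ ψ =>
          have h1 := (F.logValid_imp_iff φ ψ).1 ((F.valid_boxL_iff _).1 (ih _ (by simp)))
          exact fun V hV w hw => ((F.isWorld w hw).mem_imp_iff hV φ ψ).2 fun h => h1 V hV h
      | @boxed Γ φ h =>
          refine (F.valid_boxL_iff φ).2 ?_
          have ih' : ∀ ψ ∈ Γ, F.LogValid ψ := fun ψ hψ =>
            (F.valid_boxL_iff ψ).1 (ih _ (List.mem_map_of_mem hψ))
          rcases h with h | h
          · exact F.logValid_bmcRule h ih'
          · obtain ⟨c, hc, h⟩ := Set.mem_iUnion₂.1 h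
            exact F.logValid_condRule (hF c hc) h ih'

end Soundness

/-! ### Prime theories -/

/-- A set of formulas closed under the axioms and rules of `BM.C`. -/
structure IsRelevant (T : Set Form) : Prop where
  ax : ∀ {φ}, BMCAxiom φ → φ ∈ T
  rule : ∀ {Γ φ}, BMCRule (Γ, φ) → (∀ ψ ∈ Γ, ψ ∈ T) → φ ∈ T

/-- A set of formulas whose provable implications form a distributive lattice preorder. -/
structure IsLattice (T : Set Form) : Prop where
  refl : ∀ φ, (φ ⇛ φ) ∈ T
  trans : ∀ {φ ψ χ}, (φ ⇛ ψ) ∈ T → (ψ ⇛ χ) ∈ T → (φ ⇛ χ) ∈ T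
  conj_left : ∀ φ ψ, (φ ⋏ ψ ⇛ φ) ∈ T
  conj_right : ∀ φ ψ, (φ ⋏ ψ ⇛ ψ) ∈ T
  imp_conj : ∀ {φ ψ χ}, (φ ⇛ ψ) ∈ T → (φ ⇛ χ) ∈ T → (φ ⇛ ψ ⋏ χ) ∈ T
  left_disj : ∀ φ ψ, (φ ⇛ φ ⋎ ψ) ∈ T
  right_disj : ∀ φ ψ, (ψ ⇛ φ ⋎ ψ) ∈ T
  disj_imp : ∀ {φ ψ χ}, (φ ⇛ χ) ∈ T → (ψ ⇛ χ) ∈ T → (φ ⋎ ψ ⇛ χ) ∈ T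
  distrib : ∀ φ ψ χ, (φ ⋏ (ψ ⋎ χ) ⇛ (φ ⋏ ψ) ⋎ (φ ⋏ χ)) ∈ T

/-- A set of formulas closed under conjunction and provable implication; it may be empty. -/
structure IsTheory (T s : Set Form) : Prop where
  mem_of_imp : ∀ {φ ψ}, (φ ⇛ ψ) ∈ T → φ ∈ s → ψ ∈ s
  conj_mem : ∀ {φ ψ}, φ ∈ s → ψ ∈ s → (φ ⋏ ψ) ∈ s

/-- A theory that contains a disjunct of each of its disjunctions; it may be empty or full. -/
structure IsPrime (T s : Set Form) : Prop extends IsTheory T s where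
  disj_cases : ∀ {φ ψ}, (φ ⋎ ψ) ∈ s → φ ∈ s ∨ ψ ∈ s

/-- A set of formulas closed under disjunction and under provably implying formulas. -/
structure IsIdeal (T I : Set Form) : Prop where
  mem_of_imp : ∀ {φ ψ}, (φ ⇛ ψ) ∈ T → ψ ∈ I → φ ∈ I
  disj_mem : ∀ {φ ψ}, φ ∈ I → ψ ∈ I → (φ ⋎ ψ) ∈ I

namespace IsLattice

variable {T : Set Form} (h : IsLattice T)
include h

theorem conj_mono {φ φ' ψ ψ' : Form} (h1 : (φ ⇛ φ') ∈ T) (h2 : (ψ ⇛ ψ') ∈ T) :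
    (φ ⋏ ψ ⇛ φ' ⋏ ψ') ∈ T :=
  h.imp_conj (h.trans (h.conj_left _ _) h1) (h.trans (h.conj_right _ _) h2)

theorem disj_mono {φ φ' ψ ψ' : Form} (h1 : (φ ⇛ φ') ∈ T) (h2 : (ψ ⇛ ψ') ∈ T) :
    (φ ⋎ ψ ⇛ φ' ⋎ ψ') ∈ T :=
  h.disj_imp (h.trans h1 (h.left_disj _ _)) (h.trans h2 (h.right_disj _ _))

/-- A theory disjoint from an ideal extends to a prime theory disjoint from it. -/
theorem exists_isPrime {F I : Set Form} (hF : IsTheory T F) (hI : IsIdeal T I)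
    (hFI : ∀ φ ∈ F, φ ∉ I) : ∃ P, IsPrime T P ∧ F ⊆ P ∧ ∀ φ ∈ P, φ ∉ I := by
  obtain ⟨P, hFP, hP⟩ := zorn_subset_nonempty {P | IsTheory T P ∧ ∀ φ ∈ P, φ ∉ I}
    (fun c hc hch hne => by
      refine ⟨⋃₀ c, ⟨⟨?_, ?_⟩, ?_⟩, fun s hs => Set.subset_sUnion_of_mem hs⟩
      · rintro φ ψ h1 ⟨s, hs, hφ⟩
        exact ⟨s, hs, (hc hs).1.mem_of_imp h1 hφ⟩
      · rintro φ ψ ⟨s, hs, hφ⟩ ⟨t, ht, hψ⟩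
        rcases hch.total hs ht with hst | hst
        · exact ⟨t, ht, (hc ht).1.conj_mem (hst hφ) hψ⟩
        · exact ⟨s, hs, (hc hs).1.conj_mem hφ (hst hψ)⟩
      · rintro φ ⟨s, hs, hφ⟩
        exact (hc hs).2 φ hφ) F ⟨hF, hFI⟩
  obtain ⟨hPT, hPI⟩ := hP.prop
  -- By maximality, the theory generated by `P` and `ψ` meets the ideal. Since `P` may be empty,
  -- some member `φ` is needed for the generated set to contain `ψ`; below, the disjunction itself
  -- plays that role.
  have key : ∀ {φ ψ}, φ ∈ P → ψ ∉ P → ∃ γ ∈ P, ∃ χ ∈ I, (γ ⋏ ψ ⇛ χ) ∈ T := by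
    intro φ ψ hφ hψ
    by_contra! hcon
    refine hψ (hP.le_of_ge (y := {χ | ∃ γ ∈ P, (γ ⋏ ψ ⇛ χ) ∈ T}) ⟨⟨?_, ?_⟩, ?_⟩ ?_ ?_)
    · rintro χ χ' h1 ⟨γ, hγ, h2⟩
      exact ⟨γ, hγ, h.trans h2 h1⟩
    · rintro χ χ' ⟨γ, hγ, h1⟩ ⟨γ', hγ', h2⟩
      exact ⟨γ ⋏ γ', hPT.conj_mem hγ hγ', h.imp_conj
        (h.trans (h.conj_mono (h.conj_left _ _) (h.refl _)) h1)
        (h.trans (h.conj_mono (h.conj_right _ _) (h.refl _)) h2)⟩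
    · rintro χ ⟨γ, hγ, h1⟩ hχ
      exact hcon γ hγ χ hχ h1
    · exact fun χ hχ => ⟨χ, hχ, h.conj_left _ _⟩
    · exact ⟨φ, hφ, h.conj_right _ _⟩
  refine ⟨P, ⟨hPT, fun {φ ψ} hd => ?_⟩, hFP, hPI⟩
  by_contra! hcon
  obtain ⟨γ, hγ, χ, hχ, h1⟩ := key hd hcon.1
  obtain ⟨γ', hγ', χ', hχ', h2⟩ := key hd hcon.2
  refine hPI _ (hPT.mem_of_imp ?_ (hPT.conj_mem (hPT.conj_mem hγ hγ') hd))
    (hI.disj_mem hχ hχ')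
  exact h.trans (h.distrib _ _ _) (h.disj_mono
    (h.trans (h.conj_mono (h.conj_left _ _) (h.refl _)) h1)
    (h.trans (h.conj_mono (h.conj_right _ _) (h.refl _)) h2))

theorem isIdeal_principal (φ : Form) : IsIdeal T {χ | (χ ⇛ φ) ∈ T} :=
  ⟨fun h1 h2 => h.trans h1 h2, fun h1 h2 => h.disj_imp h1 h2⟩

theorem isTheory_principal (φ : Form) : IsTheory T {χ | (φ ⇛ χ) ∈ T} :=
  ⟨fun h1 h2 => h.trans h2 h1, fun h1 h2 => h.imp_conj h1 h2⟩

end IsLattice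

/-- The substitution that sends the three variables used in axioms to `φ`, `ψ`, `χ`. -/
def inst (φ ψ χ : Form) : ℕ → Form
  | 0 => φ
  | 1 => ψ
  | _ => χ

namespace IsRelevant

variable {T : Set Form} (h : IsRelevant T)
include h

theorem subst {φ : Form} (h1 : φ ∈ T) (σ : ℕ → Form) : φ.subst σ ∈ T :=
  h.rule (.us σ φ) (by simpa using h1)

theorem mp {φ ψ : Form} (h1 : (φ ⇛ ψ) ∈ T) (h2 : φ ∈ T) : ψ ∈ T :=
  h.rule (.mp φ ψ) (by simp [h1, h2])

theorem adj {φ ψ : Form} (h1 : φ ∈ T) (h2 : ψ ∈ T) : (φ ⋏ ψ) ∈ T :=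
  h.rule (.adj φ ψ) (by simp [h1, h2])

theorem imp_mono {φ φ' ψ ψ' : Form} (h1 : (φ' ⇛ φ) ∈ T) (h2 : (ψ ⇛ ψ') ∈ T) :
    ((φ ⇛ ψ) ⇛ (φ' ⇛ ψ')) ∈ T :=
  h.rule (.aff φ φ' ψ ψ') (by simp [h1, h2])

theorem contra {φ ψ : Form} (h1 : (φ ⇛ ψ) ∈ T) : (∼ψ ⇛ ∼φ) ∈ T :=
  h.rule (.con φ ψ) (by simp [h1])

theorem box_mono {φ ψ : Form} (h1 : (φ ⇛ ψ) ∈ T) : (□φ ⇛ □ψ) ∈ T :=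
  h.rule (.boxMon φ ψ) (by simp [h1])

theorem boxL_mono {φ ψ : Form} (h1 : (φ ⇛ ψ) ∈ T) : (⊡φ ⇛ ⊡ψ) ∈ T :=
  h.rule (.boxLMon φ ψ) (by simp [h1])

theorem imp_refl (φ : Form) : (φ ⇛ φ) ∈ T :=
  h.subst (h.ax .a1) (inst φ φ φ)

theorem imp_trans {φ ψ χ : Form} (h1 : (φ ⇛ ψ) ∈ T) (h2 : (ψ ⇛ χ) ∈ T) : (φ ⇛ χ) ∈ T :=
  h.mp (h.imp_mono h1 (h.imp_refl χ)) h2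

theorem imp_conj (φ ψ χ : Form) : ((φ ⇛ ψ) ⋏ (φ ⇛ χ) ⇛ (φ ⇛ ψ ⋏ χ)) ∈ T :=
  h.subst (h.ax .a8) (inst φ ψ χ)

theorem disj_imp (φ ψ χ : Form) : ((φ ⇛ χ) ⋏ (ψ ⇛ χ) ⇛ (φ ⋎ ψ ⇛ χ)) ∈ T :=
  h.subst (h.ax .a9) (inst φ ψ χ)

theorem isLattice : IsLattice T where
  refl := h.imp_refl
  trans := h.imp_trans
  conj_left φ ψ := h.subst (h.ax .a4) (inst φ ψ ψ)
  conj_right φ ψ := h.subst (h.ax .a5) (inst φ ψ ψ)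
  imp_conj h1 h2 := h.mp (h.imp_conj _ _ _) (h.adj h1 h2)
  left_disj φ ψ := h.subst (h.ax .a6) (inst φ ψ ψ)
  right_disj φ ψ := h.subst (h.ax .a7) (inst φ ψ ψ)
  disj_imp h1 h2 := h.mp (h.disj_imp _ _ _) (h.adj h1 h2)
  distrib φ ψ χ := h.subst (h.ax .a10) (inst φ ψ χ)

theorem neg_conj (φ ψ : Form) : (∼(φ ⋏ ψ) ⇛ ∼φ ⋎ ∼ψ) ∈ T :=
  h.subst (h.ax .a2) (inst φ ψ ψ)

theorem neg_disj (φ ψ : Form) : (∼φ ⋏ ∼ψ ⇛ ∼(φ ⋎ ψ)) ∈ T :=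
  h.subst (h.ax .a3) (inst φ ψ ψ)

theorem box_conj (φ ψ : Form) : (□φ ⋏ □ψ ⇛ □(φ ⋏ ψ)) ∈ T :=
  h.subst (h.ax .a11) (inst φ ψ ψ)

theorem boxL_conj (φ ψ : Form) : (⊡φ ⋏ ⊡ψ ⇛ ⊡(φ ⋏ ψ)) ∈ T :=
  h.subst (h.ax .a12) (inst φ ψ ψ)

theorem isTheory_self : IsTheory T T := ⟨h.mp, h.adj⟩

end IsRelevant

/-! ### Operations on theories -/

/-- The ternary relation of the canonical frame. -/
def RelR (s t v : Set Form) : Prop := ∀ φ ψ, (φ ⇛ ψ) ∈ s → φ ∈ t → ψ ∈ v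

/-- The consequents of the implications in `s` with antecedent in `t`. -/
def fusion (s t : Set Form) : Set Form := {ψ | ∃ φ ∈ t, (φ ⇛ ψ) ∈ s}

/-- The star of the canonical frame. -/
def starSet (s : Set Form) : Set Form := {φ | ∼φ ∉ s}

namespace IsRelevant

variable {T : Set Form} (h : IsRelevant T) {s t v : Set Form}
include h

/-- Affixing strengthens both antecedents to their conjunction, after which axiom (a8) joins the
consequents. -/
theorem isTheory_fusion (hs : IsTheory T s) (ht : IsTheory T t) :
    IsTheory T (fusion s t) where
  mem_of_imp := by
    rintro ψ ψ' h1 ⟨φ, hφ, h2⟩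
    exact ⟨φ, hφ, hs.mem_of_imp (h.imp_mono (h.imp_refl φ) h1) h2⟩
  conj_mem := by
    rintro ψ ψ' ⟨φ, hφ, h1⟩ ⟨φ', hφ', h2⟩
    refine ⟨φ ⋏ φ', ht.conj_mem hφ hφ', hs.mem_of_imp (h.imp_conj _ _ _) (hs.conj_mem ?_ ?_)⟩
    · exact hs.mem_of_imp (h.imp_mono (h.isLattice.conj_left _ _) (h.imp_refl _)) h1
    · exact hs.mem_of_imp (h.imp_mono (h.isLattice.conj_right _ _) (h.imp_refl _)) h2

theorem isTheory_unbox (hs : IsTheory T s) : IsTheory T {φ | □φ ∈ s} where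
  mem_of_imp h1 h2 := hs.mem_of_imp (h.box_mono h1) h2
  conj_mem h1 h2 := hs.mem_of_imp (h.box_conj _ _) (hs.conj_mem h1 h2)

theorem isTheory_unboxL (hs : IsTheory T s) : IsTheory T {φ | ⊡φ ∈ s} where
  mem_of_imp h1 h2 := hs.mem_of_imp (h.boxL_mono h1) h2
  conj_mem h1 h2 := hs.mem_of_imp (h.boxL_conj _ _) (hs.conj_mem h1 h2)

/-- The two De Morgan axioms exchange closure under conjunction with primeness. -/
theorem isPrime_starSet (hs : IsPrime T s) : IsPrime T (starSet s) where
  mem_of_imp h1 h2 h3 := h2 (hs.mem_of_imp (h.contra h1) h3)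
  conj_mem h1 h2 h3 := (hs.disj_cases (hs.mem_of_imp (h.neg_conj _ _) h3)).elim h1 h2
  disj_cases {φ ψ} h1 := by
    by_contra! h2
    exact h1 (hs.mem_of_imp (h.neg_disj _ _)
      (hs.conj_mem (not_not.1 h2.1) (not_not.1 h2.2)))

/-- These are the formulas a middle argument must avoid in order to stay related between `s` and
`v`. -/
theorem isIdeal_antecedents (hs : IsTheory T s) (hv : IsPrime T v) :
    IsIdeal T {φ | ∃ ψ ∉ v, (φ ⇛ ψ) ∈ s} where
  mem_of_imp := by
    rintro φ φ' h1 ⟨ψ, hψ, h2⟩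
    exact ⟨ψ, hψ, hs.mem_of_imp (h.imp_mono h1 (h.imp_refl ψ)) h2⟩
  disj_mem := by
    rintro φ φ' ⟨ψ, hψ, h1⟩ ⟨ψ', hψ', h2⟩
    refine ⟨ψ ⋎ ψ', fun h3 => (hv.disj_cases h3).elim hψ hψ',
      hs.mem_of_imp (h.disj_imp _ _ _) (hs.conj_mem ?_ ?_)⟩
    · exact hs.mem_of_imp (h.imp_mono (h.imp_refl _) (h.isLattice.left_disj _ _)) h1
    · exact hs.mem_of_imp (h.imp_mono (h.imp_refl _) (h.isLattice.right_disj _ _)) h2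

/-- Generated by the implications that a first argument must avoid, given `t` and `v`. -/
theorem isIdeal_failures (ht : IsTheory T t) (hv : IsPrime T v) :
    IsIdeal T {χ | ∃ φ ∈ t, ∃ ψ ∉ v, (χ ⇛ (φ ⇛ ψ)) ∈ T} where
  mem_of_imp := by
    rintro χ χ' h1 ⟨φ, hφ, ψ, hψ, h2⟩
    exact ⟨φ, hφ, ψ, hψ, h.imp_trans h1 h2⟩
  disj_mem := by
    rintro χ χ' ⟨φ, hφ, ψ, hψ, h1⟩ ⟨φ', hφ', ψ', hψ', h2⟩
    refine ⟨φ ⋏ φ', ht.conj_mem hφ hφ', ψ ⋎ ψ', fun h3 => (hv.disj_cases h3).elim hψ hψ',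
      h.isLattice.disj_imp ?_ ?_⟩
    · exact h.imp_trans h1 (h.imp_mono (h.isLattice.conj_left _ _) (h.isLattice.left_disj _ _))
    · exact h.imp_trans h2
        (h.imp_mono (h.isLattice.conj_right _ _) (h.isLattice.right_disj _ _))

/-- The middle argument of the canonical ternary relation can be extended to a prime theory. -/
theorem extend_mid (hs : IsTheory T s) (ht : IsTheory T t) (hv : IsPrime T v)
    (hR : RelR s t v) : ∃ P, IsPrime T P ∧ t ⊆ P ∧ RelR s P v := by
  obtain ⟨P, hP, htP, hPI⟩ := h.isLattice.exists_isPrime ht (h.isIdeal_antecedents hs hv)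
    fun φ hφ ⟨ψ, hψ, h1⟩ => hψ (hR φ ψ h1 hφ)
  refine ⟨P, hP, htP, fun φ ψ h1 h2 => ?_⟩
  by_contra h3
  exact hPI φ h2 ⟨ψ, h3, h1⟩

/-- The first argument of the canonical ternary relation can be extended to a prime theory. -/
theorem extend_left (hs : IsTheory T s) (ht : IsTheory T t) (hv : IsPrime T v)
    (hR : RelR s t v) : ∃ P, IsPrime T P ∧ s ⊆ P ∧ RelR P t v := by
  obtain ⟨P, hP, hsP, hPI⟩ := h.isLattice.exists_isPrime hs (h.isIdeal_failures ht hv)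
    fun χ hχ ⟨φ, hφ, ψ, hψ, h1⟩ => hψ (hR φ ψ (hs.mem_of_imp h1 hχ) hφ)
  refine ⟨P, hP, hsP, fun φ ψ h1 h2 => ?_⟩
  by_contra h3
  exact hPI _ h1 ⟨φ, h2, ψ, h3, h.imp_refl _⟩

/-- A theory that omits a formula extends to a prime theory that omits it. -/
theorem exists_isPrime_notMem (hs : IsTheory T s) {φ : Form} (hφ : φ ∉ s) :
    ∃ P, IsPrime T P ∧ s ⊆ P ∧ φ ∉ P := by
  obtain ⟨P, hP, hsP, hPI⟩ := h.isLattice.exists_isPrime hs (h.isLattice.isIdeal_principal φ)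
    fun χ hχ h1 => hφ (hs.mem_of_imp h1 hχ)
  exact ⟨P, hP, hsP, fun h1 => hPI φ h1 (h.imp_refl φ)⟩

end IsRelevant

/-! ### Classical companions -/

/-- A set `C` of formulas closed under the axioms and rules of the classical companion, except those
that come from optional conditions. -/
structure IsCompanion (C : Set Form) : Prop where
  cpc : ∀ {φ}, CPCAxiom φ → φ ∈ C
  mp : ∀ {φ ψ}, (φ ⇛ ψ) ∈ C → φ ∈ C → ψ ∈ C
  subst : ∀ {φ}, φ ∈ C → ∀ σ, Form.subst σ φ ∈ C
  bridge : ∀ {φ ψ}, ⊡(φ ⇛ ψ) ∈ C → (φ ⇛ ψ) ∈ C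
  relevant : IsRelevant {φ | ⊡φ ∈ C}

namespace IsCompanion

variable {C : Set Form} (h : IsCompanion C)
include h

theorem const {φ : Form} (ψ : Form) (h1 : φ ∈ C) : (ψ ⇛ φ) ∈ C :=
  h.mp (h.subst (h.cpc .k) (inst φ ψ ψ)) h1

theorem imp_mp {φ ψ χ : Form} (h1 : (φ ⇛ (ψ ⇛ χ)) ∈ C) (h2 : (φ ⇛ ψ) ∈ C) :
    (φ ⇛ χ) ∈ C :=
  h.mp (h.mp (h.subst (h.cpc .s) (inst φ ψ χ)) h1) h2

theorem imp_trans {φ ψ χ : Form} (h1 : (φ ⇛ ψ) ∈ C) (h2 : (ψ ⇛ χ) ∈ C) : (φ ⇛ χ) ∈ C :=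
  h.imp_mp (h.const φ h2) h1

/-- The Bridge Rule transfers most lattice laws from the relevant theorems; the closure conditions
use classical axioms. -/
theorem isLattice : IsLattice C where
  refl φ := h.bridge (h.relevant.imp_refl φ)
  trans := h.imp_trans
  conj_left φ ψ := h.bridge (h.relevant.isLattice.conj_left φ ψ)
  conj_right φ ψ := h.bridge (h.relevant.isLattice.conj_right φ ψ)
  imp_conj h1 h2 := h.imp_mp (h.imp_trans h1 (h.subst (h.cpc .conjIntro) (inst _ _ p))) h2
  left_disj φ ψ := h.bridge (h.relevant.isLattice.left_disj φ ψ)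
  right_disj φ ψ := h.bridge (h.relevant.isLattice.right_disj φ ψ)
  disj_imp h1 h2 := h.mp (h.mp (h.subst (h.cpc .disjElim) (inst _ _ _)) h1) h2
  distrib φ ψ χ := h.bridge (h.relevant.isLattice.distrib φ ψ χ)

theorem isTheory_self : IsTheory C C where
  mem_of_imp h1 h2 := h.mp h1 h2
  conj_mem {φ ψ} h1 h2 := h.mp (h.mp (h.subst (h.cpc .conjIntro) (inst φ ψ ψ)) h1) h2

theorem dne (φ : Form) : (∼∼φ ⇛ φ) ∈ C := h.subst (h.cpc .dne) (inst φ φ φ)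

theorem imp_neg {φ ψ : Form} (h1 : (φ ⇛ ψ) ∈ C) (h2 : (φ ⇛ ∼ψ) ∈ C) : ∼φ ∈ C :=
  h.mp (h.mp (h.subst (h.cpc .negIntro) (inst φ ψ ψ)) h1) h2

theorem contra {φ ψ : Form} (h1 : (φ ⇛ ψ) ∈ C) : (∼ψ ⇛ ∼φ) ∈ C := by
  have h2 : ((φ ⇛ ∼ψ) ⇛ ∼φ) ∈ C := h.mp (h.subst (h.cpc .negIntro) (inst φ ψ ψ)) h1
  exact h.imp_trans (h.subst (h.cpc .k) (inst (∼ψ) φ φ)) h2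

theorem exfalso (φ ψ : Form) : (φ ⋏ ∼φ ⇛ ψ) ∈ C := by
  have h1 : (φ ⋏ ∼φ ⇛ (∼ψ ⇛ φ)) ∈ C :=
    h.imp_trans (h.isLattice.conj_left _ _) (h.subst (h.cpc .k) (inst φ (∼ψ) ψ))
  have h2 : (φ ⋏ ∼φ ⇛ (∼ψ ⇛ ∼φ)) ∈ C :=
    h.imp_trans (h.isLattice.conj_right _ _) (h.subst (h.cpc .k) (inst (∼φ) (∼ψ) ψ))
  exact h.imp_trans (h.imp_mp (h.imp_trans h1
    (h.subst (h.cpc .negIntro) (inst (∼ψ) φ φ))) h2) (h.dne ψ)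

theorem em (φ : Form) : (φ ⋎ ∼φ) ∈ C :=
  h.mp (h.dne _) (h.imp_neg (h.contra (h.isLattice.left_disj φ (∼φ)))
    (h.contra (h.isLattice.right_disj φ (∼φ))))

end IsCompanion

/-- A maximal `C`-consistent set of formulas. -/
structure IsMaximal (C w : Set Form) : Prop extends IsPrime C w where
  subset : C ⊆ w
  ne_univ : w ≠ Set.univ

namespace IsMaximal

variable {C w : Set Form} (h : IsCompanion C) (hw : IsMaximal C w)
include h hw

theorem neg_mem_iff (φ : Form) : ∼φ ∈ w ↔ φ ∉ w := by
  refine ⟨fun h1 h2 => hw.ne_univ (Set.eq_univ_of_forall fun ψ => ?_), fun h1 => ?_⟩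
  · exact hw.mem_of_imp (h.exfalso φ ψ) (hw.conj_mem h2 h1)
  · exact (hw.disj_cases (hw.subset (h.em φ))).resolve_left h1

theorem imp_mem_iff (φ ψ : Form) : (φ ⇛ ψ) ∈ w ↔ (φ ∈ w → ψ ∈ w) := by
  refine ⟨fun h1 h2 => ?_, fun h1 => ?_⟩
  · refine hw.mem_of_imp (φ := (φ ⇛ ψ) ⋏ φ) ?_ (hw.conj_mem h1 h2)
    exact h.imp_mp (h.isLattice.conj_left _ _) (h.isLattice.conj_right _ _)
  · by_cases h2 : φ ∈ w
    · exact hw.mem_of_imp (h.subst (h.cpc .k) (inst ψ φ φ)) (h1 h2)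
    · refine hw.mem_of_imp ?_ ((hw.neg_mem_iff h φ).2 h2)
      have h3 : (∼φ ⇛ (φ ⇛ φ ⋏ ∼φ)) ∈ C := by
        have h4 : (∼φ ⇛ (φ ⇛ ∼φ)) ∈ C := h.subst (h.cpc .k) (inst (∼φ) φ φ)
        have h5 : (φ ⇛ (∼φ ⇛ φ ⋏ ∼φ)) ∈ C := h.subst (h.cpc .conjIntro) (inst φ (∼φ) φ)
        exact h.imp_trans h4 (h.mp (h.subst (h.cpc .s) (inst φ (∼φ) (φ ⋏ ∼φ))) h5)
      have h6 : (φ ⇛ (φ ⋏ ∼φ ⇛ ψ)) ∈ C := h.const φ (h.exfalso φ ψ)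
      exact h.imp_trans h3 (h.mp (h.subst (h.cpc .s) (inst φ (φ ⋏ ∼φ) ψ)) h6)

/-- The Bridge Rule turns relevantly provable implications into theorems of `C`, so worlds can serve
as states. -/
theorem isPrime : IsPrime {φ | ⊡φ ∈ C} w where
  mem_of_imp h1 h2 := hw.mem_of_imp (h.bridge h1) h2
  conj_mem := hw.conj_mem
  disj_cases := hw.disj_cases

end IsMaximal

namespace IsCompanion

variable {C : Set Form} (h : IsCompanion C)
include h

theorem exists_isMaximal_notMem {φ : Form} (hφ : φ ∉ C) : ∃ w, IsMaximal C w ∧ φ ∉ w := by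
  obtain ⟨w, hw, hCw, hwI⟩ := h.isLattice.exists_isPrime h.isTheory_self
    (h.isLattice.isIdeal_principal φ) fun χ hχ h1 => hφ (h.mp h1 hχ)
  have h1 : φ ∉ w := fun h1 => hwI φ h1 (h.isLattice.refl φ)
  exact ⟨w, ⟨hw, hCw, fun h2 => h1 (h2 ▸ Set.mem_univ φ)⟩, h1⟩

/-- A prime theory that contains the relevant theorems is accessible from a maximal consistent
set. -/
theorem exists_isMaximal_unboxL_subset (hC : C ≠ Set.univ) {v : Set Form}
    (hv : IsPrime {φ | ⊡φ ∈ C} v) (hsub : {φ | ⊡φ ∈ C} ⊆ v) :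
    ∃ w, IsMaximal C w ∧ ∀ φ, ⊡φ ∈ w → φ ∈ v := by
  -- For full `v` any maximal set works. Otherwise a formula missing from `v` shows that the set
  -- constructed below is proper.
  by_cases hu : v = Set.univ
  · obtain ⟨φ, hφ⟩ := (Set.ne_univ_iff_exists_notMem C).1 hC
    obtain ⟨w, hw, -⟩ := h.exists_isMaximal_notMem hφ
    exact ⟨w, hw, fun φ _ => hu ▸ Set.mem_univ φ⟩
  obtain ⟨φ, hφ⟩ := (Set.ne_univ_iff_exists_notMem v).1 hu
  -- Avoiding this ideal says exactly that `⊡ψ ∈ w` forces `ψ ∈ v`; primeness of `v` and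
  -- monotonicity of `⊡` give closure under disjunction.
  have hI : IsIdeal C {χ | ∃ ψ ∉ v, (χ ⇛ ⊡ψ) ∈ C} := by
    refine ⟨?_, ?_⟩
    · rintro χ χ' h1 ⟨ψ, hψ, h2⟩
      exact ⟨ψ, hψ, h.imp_trans h1 h2⟩
    · rintro χ χ' ⟨ψ, hψ, h1⟩ ⟨ψ', hψ', h2⟩
      refine ⟨ψ ⋎ ψ', fun h3 => (hv.disj_cases h3).elim hψ hψ', h.isLattice.disj_imp ?_ ?_⟩
      · exact h.imp_trans h1
          (h.bridge (h.relevant.boxL_mono (h.relevant.isLattice.left_disj _ _)))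
      · exact h.imp_trans h2
          (h.bridge (h.relevant.boxL_mono (h.relevant.isLattice.right_disj _ _)))
  obtain ⟨w, hw, hCw, hwI⟩ := h.isLattice.exists_isPrime h.isTheory_self hI
    fun χ hχ ⟨ψ, hψ, h1⟩ => hψ (hsub (h.mp h1 hχ))
  have hn : ∀ ψ, ⊡ψ ∈ w → ψ ∈ v := fun ψ h1 => by
    by_contra h2
    exact hwI _ h1 ⟨ψ, h2, h.isLattice.refl _⟩
  exact ⟨w, ⟨hw, hCw, fun h1 => hφ (hn φ (h1 ▸ Set.mem_univ (⊡φ)))⟩, hn⟩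

end IsCompanion

/-! ### The canonical frame -/

/-- States of the canonical frame: prime theories, in an arbitrary universe. -/
@[ext]
structure State (T : Set Form) : Type u where
  carrier : Set Form
  isPrime : IsPrime T carrier

namespace State

variable {T : Set Form}

instance : PartialOrder (State.{u} T) := PartialOrder.lift State.carrier fun _ _ => State.ext

instance : BoundedOrder (State.{u} T) where
  top := ⟨Set.univ, ⟨⟨fun _ _ => trivial, fun _ _ => trivial⟩, fun _ => .inl trivial⟩⟩
  le_top s := Set.subset_univ s.carrier
  bot := ⟨∅, ⟨⟨fun _ h => h, fun h _ => h⟩, fun h => .inl h⟩⟩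
  bot_le s := Set.empty_subset s.carrier

theorem eq_top_iff_carrier {s : State.{u} T} : s = ⊤ ↔ ∀ φ, φ ∈ s.carrier :=
  ⟨fun h _ => h ▸ trivial, fun h => State.ext (Set.eq_univ_of_forall h)⟩

theorem eq_bot_iff_carrier {s : State.{u} T} : s = ⊥ ↔ ∀ φ, φ ∉ s.carrier :=
  ⟨fun h _ => h ▸ id, fun h => State.ext (Set.eq_empty_of_forall_notMem h)⟩

end State

/-- The canonical frame of a set of relevant theorems. -/
def canonicalFrame {T : Set Form} (h : IsRelevant T) : Frame (State.{u} T) where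
  R s t v := RelR s.carrier t.carrier v.carrier
  star s := ⟨starSet s.carrier, h.isPrime_starSet s.isPrime⟩
  Q s t := ∀ φ, □φ ∈ s.carrier → φ ∈ t.carrier
  QL s t := ∀ φ, ⊡φ ∈ s.carrier → φ ∈ t.carrier
  R_tonic hs ht hv hR φ ψ h1 h2 := hv (hR φ ψ (hs h1) (ht h2))
  star_anti hst _ h1 h2 := h1 (hst h2)
  Q_tonic hs ht hQ φ h1 := ht (hQ φ (hs h1))
  QL_tonic hs ht hQ φ h1 := ht (hQ φ (hs h1))

/-- The valuation of the canonical model. -/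
def canonicalValuation (T : Set Form) : ℕ → Set (State.{u} T) :=
  fun n => {s | .var n ∈ s.carrier}

theorem isValuation_canonicalValuation (T : Set Form) :
    IsValuation (canonicalValuation.{u} T) where
  upper _ _ _ hst hs := hst hs
  top_mem _ := trivial
  bot_notMem _ := id

namespace IsRelevant

variable {T : Set Form} (h : IsRelevant T)
include h

/-- The truth lemma. -/
theorem mem_interp_canonicalFrame (φ : Form) (s : State.{u} T) :
    s ∈ (canonicalFrame h).interp (canonicalValuation T) φ ↔ φ ∈ s.carrier := by
  induction φ generalizing s with
  | var n => rfl
  | conj φ ψ h1 h2 =>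
      refine (and_congr (h1 s) (h2 s)).trans ⟨fun h3 => s.isPrime.conj_mem h3.1 h3.2, fun h3 => ?_⟩
      exact ⟨s.isPrime.mem_of_imp (h.isLattice.conj_left _ _) h3,
        s.isPrime.mem_of_imp (h.isLattice.conj_right _ _) h3⟩
  | disj φ ψ h1 h2 =>
      refine (or_congr (h1 s) (h2 s)).trans ⟨fun h3 => ?_, s.isPrime.disj_cases⟩
      exact h3.elim (s.isPrime.mem_of_imp (h.isLattice.left_disj _ _))
        (s.isPrime.mem_of_imp (h.isLattice.right_disj _ _))
  | imp φ ψ h1 h2 =>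
      refine ⟨fun h3 => ?_, fun h3 t v hR ht =>
        (h2 v).2 (hR φ ψ h3 ((h1 t).1 ht))⟩
      by_contra h4
      -- The least possible antecedent theory is the one generated by `φ`. Its fusion with `s` omits
      -- `ψ`, so the consequent is made prime first, then the antecedent.
      have hφ := h.isLattice.isTheory_principal φ
      obtain ⟨v, hv, hsv, hψ⟩ := h.exists_isPrime_notMem
        (h.isTheory_fusion s.isPrime.toIsTheory hφ) (φ := ψ) (by
          rintro ⟨α, hα, h5⟩
          exact h4 (s.isPrime.mem_of_imp (h.imp_mono hα (h.imp_refl ψ)) h5))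
      obtain ⟨t, ht, hφt, hR⟩ := h.extend_mid s.isPrime.toIsTheory hφ hv
        fun α β h5 h6 => hsv ⟨α, h6, h5⟩
      exact hψ ((h2 ⟨v, hv⟩).1
        (h3 ⟨t, ht⟩ ⟨v, hv⟩ hR ((h1 ⟨t, ht⟩).2 (hφt (h.imp_refl φ)))))
  | neg φ h1 => exact (not_congr (h1 _)).trans not_not
  | box φ h1 =>
      refine ⟨fun h3 => ?_, fun h3 t hQ => (h1 t).2 (hQ φ h3)⟩
      by_contra h4
      obtain ⟨t, ht, hst, hφ⟩ :=
        h.exists_isPrime_notMem (h.isTheory_unbox s.isPrime.toIsTheory) h4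
      exact hφ ((h1 ⟨t, ht⟩).1 (h3 ⟨t, ht⟩ fun _ h5 => hst h5))
  | boxL φ h1 =>
      refine ⟨fun h3 => ?_, fun h3 t hQ => (h1 t).2 (hQ φ h3)⟩
      by_contra h4
      obtain ⟨t, ht, hst, hφ⟩ :=
        h.exists_isPrime_notMem (h.isTheory_unboxL s.isPrime.toIsTheory) h4
      exact hφ ((h1 ⟨t, ht⟩).1 (h3 ⟨t, ht⟩ fun _ h5 => hst h5))

/-- The canonical frame satisfies every condition whose axiom and rule it is closed under. -/
theorem satisfies_canonicalFrame {c : Cond} (hax : exactAxiom c ⊆ T)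
    (hrule : ∀ {Γ φ}, (Γ, φ) ∈ condRule c → (∀ ψ ∈ Γ, ψ ∈ T) → φ ∈ T)
    {L : Set (State.{u} T)} (hL : ∀ s, s ∈ L ↔ T ⊆ s.carrier) :
    (canonicalFrame h).Satisfies L c := by
  cases c
  case DN =>
    have h0 : (p ⇛ ∼∼p) ⋏ (∼∼p ⇛ p) ∈ T := hax rfl
    have h1 : ∀ φ, (φ ⇛ ∼∼φ) ∈ T := fun φ =>
      h.subst (h.mp (h.isLattice.conj_left _ _) h0) (inst φ φ φ)
    have h2 : ∀ φ, (∼∼φ ⇛ φ) ∈ T := fun φ =>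
      h.subst (h.mp (h.isLattice.conj_right _ _) h0) (inst φ φ φ)
    refine fun s => State.ext (Set.ext fun φ => not_not.trans ⟨?_, ?_⟩)
    · exact s.isPrime.mem_of_imp (h2 φ)
    · exact s.isPrime.mem_of_imp (h1 φ)
  case Cp =>
    intro s t v hR φ ψ h1 h2 h3
    have h4 : ((φ ⇛ ψ) ⇛ (∼ψ ⇛ ∼φ)) ∈ T := h.subst (hax rfl) (inst φ ψ ψ)
    exact h2 (hR _ _ (s.isPrime.mem_of_imp h4 h1) h3)
  case WB =>
    intro s t v hR
    -- The fusion is the least candidate for `x`: one relation holds for every extension of it, and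
    -- the axiom gives the other, which the prime extension preserves. The cases (B), (CB), (W) and
    -- (C) follow this pattern.
    have hx := h.isTheory_fusion s.isPrime.toIsTheory t.isPrime.toIsTheory
    obtain ⟨x, hx, htx, hxR⟩ := h.extend_mid s.isPrime.toIsTheory hx v.isPrime (by
      rintro φ ψ h1 ⟨χ, hχ, h2⟩
      have h3 : ((χ ⇛ φ) ⋏ (φ ⇛ ψ) ⇛ (χ ⇛ ψ)) ∈ T := h.subst (hax rfl) (inst χ φ ψ)
      exact hR χ ψ (s.isPrime.mem_of_imp h3 (s.isPrime.conj_mem h2 h1)) hχ)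
    exact ⟨⟨x, hx⟩, hxR, fun φ ψ h1 h2 => htx ⟨φ, h2, h1⟩⟩
  case X =>
    intro s hs φ h1
    have h2 : (φ ⋎ ∼φ) ∈ T := h.subst (hax rfl) (inst φ φ φ)
    exact (s.isPrime.disj_cases ((hL s).1 hs h2)).resolve_right h1
  case Rd =>
    intro s φ ψ h1 h2
    have h3 : ((φ ⇛ ψ) ⇛ ∼φ ⋎ ψ) ∈ T := h.subst (hax rfl) (inst φ ψ ψ)
    exact (s.isPrime.disj_cases (s.isPrime.mem_of_imp h3 h1)).resolve_left h2
  case B =>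
    rintro s t v z ⟨x, hR, hR'⟩
    have hy := h.isTheory_fusion t.isPrime.toIsTheory v.isPrime.toIsTheory
    obtain ⟨y, hy, hty, hyR⟩ := h.extend_mid s.isPrime.toIsTheory hy z.isPrime (by
      rintro φ ψ h1 ⟨χ, hχ, h2⟩
      have h3 : ((φ ⇛ ψ) ⇛ ((χ ⇛ φ) ⇛ (χ ⇛ ψ))) ∈ T := h.subst (hax rfl) (inst φ ψ χ)
      exact hR' χ ψ (hR _ _ (s.isPrime.mem_of_imp h3 h1) h2) hχ)
    exact ⟨⟨y, hy⟩, hyR, fun φ ψ h1 h2 => hty ⟨φ, h2, h1⟩⟩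
  case CB =>
    rintro s t v z ⟨x, hR, hR'⟩
    have hy := h.isTheory_fusion s.isPrime.toIsTheory v.isPrime.toIsTheory
    obtain ⟨y, hy, hsy, hyR⟩ := h.extend_mid t.isPrime.toIsTheory hy z.isPrime (by
      rintro φ ψ h1 ⟨χ, hχ, h2⟩
      have h3 : ((χ ⇛ φ) ⇛ ((φ ⇛ ψ) ⇛ (χ ⇛ ψ))) ∈ T := h.subst (hax rfl) (inst χ φ ψ)
      exact hR' χ ψ (hR _ _ (s.isPrime.mem_of_imp h3 h2) h1) hχ)
    exact ⟨⟨y, hy⟩, hyR, fun φ ψ h1 h2 => hsy ⟨φ, h2, h1⟩⟩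
  case W =>
    intro s t v hR
    have hx := h.isTheory_fusion s.isPrime.toIsTheory t.isPrime.toIsTheory
    obtain ⟨x, hx, htx, hxR⟩ := h.extend_left hx t.isPrime.toIsTheory v.isPrime (by
      rintro φ ψ ⟨χ, hχ, h1⟩ h2
      -- Contraction needs equal antecedents, so both are strengthened to `φ ⋏ χ`, which lies in
      -- `t`.
      have h3 : ((φ ⋏ χ ⇛ (φ ⋏ χ ⇛ ψ)) ⇛ (φ ⋏ χ ⇛ ψ)) ∈ T :=
        h.subst (hax rfl) (inst (φ ⋏ χ) ψ ψ)
      have h4 : ((χ ⇛ (φ ⇛ ψ)) ⇛ (φ ⋏ χ ⇛ (φ ⋏ χ ⇛ ψ))) ∈ T :=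
        h.imp_mono (h.isLattice.conj_right _ _)
          (h.imp_mono (h.isLattice.conj_left _ _) (h.imp_refl _))
      exact hR _ ψ (s.isPrime.mem_of_imp (h.imp_trans h4 h3) h1) (t.isPrime.conj_mem h2 hχ))
    exact ⟨⟨x, hx⟩, fun φ ψ h1 h2 => htx ⟨φ, h2, h1⟩, hxR⟩
  case C =>
    rintro s t v z ⟨x, hR, hR'⟩
    have hy := h.isTheory_fusion s.isPrime.toIsTheory v.isPrime.toIsTheory
    obtain ⟨y, hy, hsy, hyR⟩ := h.extend_left hy t.isPrime.toIsTheory z.isPrime (by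
      rintro φ ψ ⟨χ, hχ, h1⟩ h2
      have h3 : ((χ ⇛ (φ ⇛ ψ)) ⇛ (φ ⇛ (χ ⇛ ψ))) ∈ T := h.subst (hax rfl) (inst χ φ ψ)
      exact hR' χ ψ (hR _ _ (s.isPrime.mem_of_imp h3 h1) h2) hχ)
    exact ⟨⟨y, hy⟩, fun φ ψ h1 h2 => hsy ⟨φ, h2, h1⟩, hyR⟩
  case M =>
    intro s t v hR
    by_contra! hcon
    obtain ⟨φ, hφ, hφ'⟩ := Set.not_subset.1 hcon.1
    obtain ⟨ψ, hψ, hψ'⟩ := Set.not_subset.1 hcon.2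
    have h1 : (φ ⋎ ψ ⇛ (φ ⋎ ψ ⇛ φ ⋎ ψ)) ∈ T := h.subst (hax rfl) (inst (φ ⋎ ψ) φ φ)
    have h2 := hR _ _ (s.isPrime.mem_of_imp (h.imp_trans (h.isLattice.left_disj φ ψ) h1) hφ)
      (t.isPrime.mem_of_imp (h.isLattice.right_disj φ ψ) hψ)
    exact (v.isPrime.disj_cases h2).elim hφ' hψ'
  case ER =>
    intro s
    -- The rule says that `T` itself, as middle argument, relates `s` to `s`.
    obtain ⟨x, hx, hTx, hR⟩ := h.extend_mid s.isPrime.toIsTheory h.isTheory_self s.isPrime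
      fun φ ψ h1 h2 => s.isPrime.mem_of_imp
        (hrule (Γ := [φ]) (φ := (φ ⇛ ψ) ⇛ ψ) ⟨φ, ψ, rfl⟩ (by simpa using h2)) h1
    exact ⟨⟨x, hx⟩, (hL _).2 hTx, hR⟩
  case Nec =>
    rintro x s ⟨hx, hQ⟩
    exact (hL s).2 fun φ h1 => hQ φ
      ((hL x).1 hx (hrule (Γ := [φ]) (φ := □φ) ⟨φ, rfl⟩ (by simpa using h1)))
  case boxK =>
    rintro s t v ⟨y, hR, hQ⟩
    have ht := h.isTheory_unbox t.isPrime.toIsTheory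
    obtain ⟨z, hz, hsz, hzR⟩ := h.extend_left (h.isTheory_unbox s.isPrime.toIsTheory) ht
      v.isPrime fun φ ψ h1 h2 => by
        have h3 : (□(φ ⇛ ψ) ⇛ (□φ ⇛ □ψ)) ∈ T := h.subst (hax rfl) (inst φ ψ ψ)
        exact hQ ψ (hR _ _ (s.isPrime.mem_of_imp h3 h1) h2)
    obtain ⟨x, hx, htx, hxR⟩ := h.extend_mid hz.toIsTheory ht v.isPrime hzR
    exact ⟨⟨x, hx⟩, fun _ h1 => htx h1, ⟨z, hz⟩, fun _ h1 => hsz h1, hxR⟩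
  case boxT =>
    exact fun s φ h1 => s.isPrime.mem_of_imp (h.subst (hax rfl) (inst φ φ φ)) h1
  case boxD =>
    intro s
    -- Avoiding this ideal yields `Q s (star x)`; extending the unboxed part of `star s` yields `Q
    -- (star s) x`.
    have hI : IsIdeal T {χ | ∃ φ, □φ ∈ s.carrier ∧ (χ ⇛ ∼φ) ∈ T} := by
      refine ⟨?_, ?_⟩
      · rintro χ χ' h1 ⟨φ, hφ, h2⟩
        exact ⟨φ, hφ, h.imp_trans h1 h2⟩
      · rintro χ χ' ⟨φ, hφ, h1⟩ ⟨φ', hφ', h2⟩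
        refine ⟨φ ⋏ φ', s.isPrime.mem_of_imp (h.box_conj _ _) (s.isPrime.conj_mem hφ hφ'),
          h.isLattice.disj_imp ?_ ?_⟩
        · exact h.imp_trans h1 (h.contra (h.isLattice.conj_left _ _))
        · exact h.imp_trans h2 (h.contra (h.isLattice.conj_right _ _))
    obtain ⟨x, hx, hsx, hxI⟩ := h.isLattice.exists_isPrime
      (h.isTheory_unbox (h.isPrime_starSet s.isPrime).toIsTheory) hI (by
        rintro χ hχ ⟨φ, hφ, h1⟩
        have h2 : (□φ ⇛ ∼□∼φ) ∈ T := h.subst (hax rfl) (inst φ φ φ)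
        exact hχ (s.isPrime.mem_of_imp (h.imp_trans h2 (h.contra (h.box_mono h1))) hφ))
    exact ⟨⟨x, hx⟩, fun φ h1 h2 => hxI _ h2 ⟨φ, h1, h.imp_refl _⟩, fun φ h1 => hsx h1⟩
  case box4 =>
    rintro s t v ⟨h1, h2⟩ φ h3
    have h4 : (□φ ⇛ □□φ) ∈ T := h.subst (hax rfl) (inst φ φ φ)
    exact h2 φ (h1 _ (s.isPrime.mem_of_imp h4 h3))
  case box5 =>
    rintro s t v ⟨h1, h2⟩ φ h3
    have h4 : (∼□φ ⇛ □∼□φ) ∈ T := h.subst (hax rfl) (inst φ φ φ)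
    exact h1 φ fun h5 => h3 (h2 _ (s.isPrime.mem_of_imp h4 h5))

end IsRelevant

/-- The canonical `W`-frame of a classical companion. -/
def canonicalWFrame {C : Set Form} (h : IsCompanion C) (hC : C ≠ Set.univ) :
    WFrame (State.{u} {φ | ⊡φ ∈ C}) where
  toFrame := canonicalFrame h.relevant
  star_top := State.ext (Set.eq_empty_of_forall_notMem fun _ h1 => h1 trivial)
  star_bot := State.ext (Set.eq_univ_of_forall fun _ => id)
  Q_bot _ := id
  QL_bot _ := id
  Q_top _ h1 := State.eq_top_iff_carrier.2 fun φ => h1 φ trivial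
  QL_top _ h1 := State.eq_top_iff_carrier.2 fun φ => h1 φ trivial
  R_bot_top_bot _ _ h1 _ := h1
  R_top s t hR := by
    rw [State.eq_bot_iff_carrier, State.eq_top_iff_carrier]
    by_contra! hcon
    obtain ⟨⟨φ, hφ⟩, ψ, hψ⟩ := hcon
    exact hψ (hR φ ψ trivial hφ)
  W := {w | IsMaximal C w.carrier}
  isWorld w hw :=
    have hstar : starSet w.carrier = w.carrier :=
      Set.ext fun φ => (not_congr (IsMaximal.neg_mem_iff h hw φ)).trans not_not
    { star_eq := State.ext hstar
      R_self := fun φ ψ => (IsMaximal.imp_mem_iff h hw φ ψ).1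
      R_le := fun s t hR => by
        rw [State.eq_bot_iff_carrier, or_iff_not_imp_left]
        intro h1 ψ hψ
        push Not at h1
        obtain ⟨φ, hφ⟩ := h1
        -- Material implication: a true consequent suffices here, a false antecedent in `R_star`.
        exact hR φ ψ ((IsMaximal.imp_mem_iff h hw φ ψ).2 fun _ => hψ) hφ
      R_star := fun s t hR => by
        rw [State.eq_top_iff_carrier, or_iff_not_imp_left]
        intro h1 φ hφ
        push Not at h1
        obtain ⟨ψ, hψ⟩ := h1
        refine hstar.ge ?_
        by_contra h2
        exact hψ (hR φ ψ ((IsMaximal.imp_mem_iff h hw φ ψ).2 fun h3 => absurd h3 h2) hφ) }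
  QL_le w hw s t v hv hR φ hφ :=
    hR φ φ (hv _ (hw.subset (h.relevant.imp_refl φ))) hφ
  QL_refl s := by
    -- The relevant theorems relate `s` to itself; a prime extension keeping this is accessible from
    -- a world.
    obtain ⟨v, hv, hsub, hR⟩ := h.relevant.extend_left h.relevant.isTheory_self
      s.isPrime.toIsTheory s.isPrime fun _ _ h1 h2 => s.isPrime.mem_of_imp h1 h2
    obtain ⟨w, hw, hwv⟩ := h.exists_isMaximal_unboxL_subset hC hv hsub
    exact ⟨⟨w, hw.isPrime h⟩, hw, ⟨v, hv⟩, hwv, hR⟩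

/-! ### Completeness and comparison of the two axiom tables -/

namespace IsCompanion

variable {C : Set Form} (h : IsCompanion C)
include h

theorem mem_logical_canonicalWFrame (hC : C ≠ Set.univ) (s : State.{u} {φ | ⊡φ ∈ C}) :
    s ∈ (canonicalWFrame h hC).logical ↔ {φ | ⊡φ ∈ C} ⊆ s.carrier := by
  refine ⟨fun ⟨w, hw, hQ⟩ φ hφ => hQ φ (hw.subset hφ), fun h1 => ?_⟩
  obtain ⟨w, hw, hws⟩ := h.exists_isMaximal_unboxL_subset hC s.isPrime h1
  exact ⟨⟨w, hw.isPrime h⟩, hw, hws⟩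

/-- A companion closed under the axioms and rules of the selected conditions is complete. -/
theorem cLogic_subset {Λ : Set Cond} (hax : ∀ c ∈ Λ, ∀ φ ∈ exactAxiom c, ⊡φ ∈ C)
    (hrule : ∀ c ∈ Λ, ∀ {Γ φ}, (Γ, φ) ∈ condRule c → (∀ ψ ∈ Γ, ⊡ψ ∈ C) → ⊡φ ∈ C) :
    CLogic.{u} Λ ⊆ C := by
  intro φ hφ
  by_contra h1
  have hC : C ≠ Set.univ := fun h2 => h1 (h2 ▸ Set.mem_univ φ)
  obtain ⟨w, hw, hwφ⟩ := h.exists_isMaximal_notMem h1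
  have h2 := hφ (State.{u} {φ | ⊡φ ∈ C}) (canonicalWFrame h hC)
    (fun c hc => h.relevant.satisfies_canonicalFrame (fun ψ hψ => hax c hc ψ hψ)
      (hrule c hc) (h.mem_logical_canonicalWFrame hC))
    _ (isValuation_canonicalValuation _) (show (⟨w, hw.isPrime h⟩ : State _) ∈ _ from hw)
  exact hwφ ((h.relevant.mem_interp_canonicalFrame φ ⟨w, hw.isPrime h⟩).1 h2)

end IsCompanion

theorem isCompanion_classical (ax : Cond → Set Form) (Λ : Set Cond) :
    IsCompanion (relSystem ax Λ).classical.Th where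
  cpc h := .ax (.inl h)
  mp {φ ψ} h1 h2 := .rule (CLRule.mp φ ψ) (by simpa [AxSystem.Th] using And.intro h2 h1)
  subst {φ} h1 σ := .rule (CLRule.us σ φ) (by simpa [AxSystem.Th] using h1)
  bridge {φ ψ} h1 := .rule (CLRule.bridge φ ψ) (by simpa [AxSystem.Th] using h1)
  relevant :=
    { ax := fun h => .ax (.inr ⟨_, .inl h, rfl⟩)
      rule := fun h hΓ => .rule (CLRule.boxed (.inl h)) (by simpa [AxSystem.Th] using hΓ) }

theorem IsRelevant.exactAxiom_subset {T : Set Form} (h : IsRelevant T) {c : Cond}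
    (hax : tableAxiom c ⊆ T) (hDN : c = .Rd ∨ c = .boxD → tableAxiom .DN ⊆ T) :
    exactAxiom c ⊆ T := by
  cases c <;> try exact hax
  case Rd =>
    rintro _ rfl
    have h1 : (q ⇛ ∼∼q) ∈ T := h.mp (h.isLattice.conj_left _ _)
      (h.subst (hDN (.inl rfl) rfl) (inst q q q))
    have h2 : (∼∼q ⇛ q) ∈ T := h.mp (h.isLattice.conj_right _ _)
      (h.subst (hDN (.inl rfl) rfl) (inst q q q))
    -- The reductio axiom is instantiated at `p ⋏ ∼q`, since De Morgan and (DN) turn its negation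
    -- into `∼p ⋎ q`.
    have h3 : (p ⋏ ∼q ⇛ ∼(p ⋏ ∼q)) ⇛ ∼(p ⋏ ∼q) ∈ T :=
      h.subst (hax rfl) (inst (p ⋏ ∼q) q q)
    have h4 : (p ⇛ q) ⇛ (p ⋏ ∼q ⇛ ∼(p ⋏ ∼q)) ∈ T := h.imp_mono (h.isLattice.conj_left _ _)
      (h.imp_trans h1 (h.contra (h.isLattice.conj_right _ _)))
    exact h.imp_trans (h.imp_trans h4 h3) (h.imp_trans (h.neg_conj _ _)
      (h.isLattice.disj_mono (h.imp_refl _) h2))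
  case boxD =>
    rintro _ rfl
    have h1 : (p ⇛ ∼∼p) ∈ T := h.mp (h.isLattice.conj_left _ _) (hDN (.inr rfl) rfl)
    have h2 : (□∼∼p ⇛ ∼□∼p) ∈ T := h.subst (hax rfl) (inst (∼p) p p)
    exact h.imp_trans (h.box_mono h1) h2

theorem cLogic_subset_classical {ax : Cond → Set Form} {Λ : Set Cond}
    (hax : ∀ c ∈ Λ, ∀ φ ∈ exactAxiom c, ⊡φ ∈ (relSystem ax Λ).classical.Th) :
    CLogic.{u} Λ ⊆ (relSystem ax Λ).classical.Th :=
  (isCompanion_classical ax Λ).cLogic_subset hax fun c hc _ _ h hΓ =>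
    .rule (CLRule.boxed (.inr (Set.mem_iUnion₂.2 ⟨c, hc, h⟩))) (by simpa [AxSystem.Th] using hΓ)

theorem boxL_mem_classical {ax : Cond → Set Form} {Λ : Set Cond} {c : Cond} (hc : c ∈ Λ)
    {φ : Form} (hφ : φ ∈ ax c) : ⊡φ ∈ (relSystem ax Λ).classical.Th :=
  .ax (.inr ⟨φ, .inr (Set.mem_iUnion₂.2 ⟨c, hc, hφ⟩), rfl⟩)

end RelML

theorem mainTheorem1 :
    (∀ Λ : Set RelML.Cond,
      (RelML.relSystem RelML.exactAxiom Λ).classical.Th = RelML.CLogic.{u} Λ) ∧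
    (∀ Λ : Set RelML.Cond,
      (RelML.Cond.Rd ∈ Λ ∨ RelML.Cond.boxD ∈ Λ → RelML.Cond.DN ∈ Λ) →
      (RelML.relSystem RelML.tableAxiom Λ).classical.Th = RelML.CLogic.{u} Λ) := by
  refine ⟨fun Λ => Set.Subset.antisymm ?_ ?_, fun Λ hΛ => Set.Subset.antisymm ?_ ?_⟩
  · exact RelML.soundness fun S _ _ F hF c hc φ hφ => F.logValid_exactAxiom (hF c hc) hφ
  · exact RelML.cLogic_subset_classical fun c hc φ hφ => RelML.boxL_mem_classical hc hφ
  · refine RelML.soundness fun S _ _ F hF c hc φ hφ => F.logValid_tableAxiom (hF c hc) ?_ hφ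
    rintro rfl
    exact hF _ (hΛ (.inr hc))
  · refine RelML.cLogic_subset_classical fun c hc =>
      (RelML.isCompanion_classical _ Λ).relevant.exactAxiom_subset
        (fun φ hφ => RelML.boxL_mem_classical hc hφ) fun h φ hφ =>
          RelML.boxL_mem_classical (hΛ ?_) hφ
    rcases h with rfl | rfl
    · exact .inl hc
    · exact .inr hc
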